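/- Let $n,m\ge 0$, $\gamma>0$, $L\ge 0$, and let $f:\mathbb R^n\times\mathbb R^m\to\mathbb R^n$ and $r:\mathbb R^n\times\mathbb R^m\to\mathbb R$ be bounded and Lipschitz continuous. Let $\mathcal A$ be the set of Lipschitz continuous $a:[0,\infty)\to\mathbb R^m$ with $|\dot a(t)|\le L$ for a.e. $t$, and define \[ Q(\boldsymbol x,\boldsymbol a)=\sup\Big\{\int_0^\infty e^{-\gamma t}r(x(t),a(t))\,dt \;:\; a\in\mathcal A,\ a(0)=\boldsymbol a,\ \dot x=f(x,a),\ x(0)=\boldsymbol x\Big\}. \] For $h>0$ let $\xi(\boldsymbol x,\boldsymbol a;h)$ be the state at time $h$ of $\dot x=f(x,\boldsymbol a)$, $x(0)=\boldsymbol x$, with constant action $\boldsymbol a$. Given learning rates $(\alpha_k)_{k\ge 0}$ and initial functions $Q^h_0:\mathbb R^n\times\mathbb R^m\to\mathbb R$, define for $k\ge 0$ \[ Q^h_{k+1}(\boldsymbol x,\boldsymbol a)=(1-\alpha_k)Q^h_k(\boldsymbol x,\boldsymbol a)+\alpha_k\Big[h\,r(\boldsymbol x,\boldsymbol a)+(1-\gamma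 h)\sup_{|\boldsymbol b|\le L}Q^h_k\big(\xi(\boldsymbol x,\boldsymbol a;h),\boldsymbol a+h\boldsymbol b\big)\Big]. \] Assume that $0\le\alpha_k\le 1$ for all $k$, that $\sum_{k=0}^\infty\alpha_k=\infty$, and that the initial functions are bounded uniformly in $h$ for small $h$, that is, there are $M$ and $h_0>0$ with $|Q^h_0|\le M$ on $\mathbb R^n\times\mathbb R^m$ for all $0<h<h_0$. Then one can choose nonnegative integers $k_h$ such that $h\sum_{\tau=0}^{k_h-1}\alpha_\tau\to\infty$ as $h\to 0^+$. Moreover, for every such choice of $k_h$ and every compact $K\subset\mathbb R^n\times\mathbb R^m$, \[ \lim_{h\to 0^+}\ \sup_{k\ge k_h}\ \sup_{(\boldsymbol x,\boldsymbol a)\in K}\big|Q^h_k(\boldsymbol x,\boldsymbol a)-Q(\boldsymbol x,\boldsymbol a)\big|=0. \] -/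

import Mathlib

open Set Filter Topology MeasureTheory
open scoped NNReal ENNReal

noncomputable section

namespace HJQ

/-- The Euclidean space `ℝᵈ`. -/
abbrev E (d : ℕ) : Type := EuclideanSpace ℝ (Fin d)

/-- The function `g` of the state and the action is bounded and (globally) Lipschitz continuous. -/
def BoundedLipschitz {n m : ℕ} {F : Type*} [NormedAddCommGroup F] (g : E n × E m → F) : Prop :=
  (∃ C : ℝ, ∀ z, ‖g z‖ ≤ C) ∧ ∃ C : ℝ≥0, LipschitzWith C g

/-- Admissible controls: Lipschitz continuous functions `a : [0, ∞) → ℝᵐ` with `|ȧ(t)| ≤ L` for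
almost every `t`. (A Lipschitz continuous function is differentiable almost everywhere. Only the
values of `a` on `[0, ∞)` matter.) -/
def IsAdmissible {m : ℕ} (L : ℝ) (a : ℝ → E m) : Prop :=
  (∃ C : ℝ≥0, LipschitzOnWith C a (Ici 0)) ∧
    ∀ᵐ t ∂(volume.restrict (Ioi (0 : ℝ))), ‖deriv a t‖ ≤ L

/-- `x` solves `ẋ(t) = f (x(t), a(t))` on `[0, ∞)` with `x(0) = x₀`. -/
def IsTrajectory {n m : ℕ} (f : E n × E m → E n) (a : ℝ → E m) (x₀ : E n) (x : ℝ → E n) : Prop :=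
  x 0 = x₀ ∧ ∀ t ∈ Ici (0 : ℝ), HasDerivWithinAt x (f (x t, a t)) (Ici 0) t

/-- The discounted reward `∫₀^∞ e^{-γ t} r (x(t), a(t)) dt`. -/
def reward {n m : ℕ} (r : E n × E m → ℝ) (γ : ℝ) (x : ℝ → E n) (a : ℝ → E m) : ℝ :=
  ∫ t in Ioi (0 : ℝ), Real.exp (-γ * t) * r (x t, a t)

/-- The continuous-time Q-function: the supremum of the discounted reward over all admissible
controls `a` with `a(0) = z.2`, along the state trajectory that starts from `x(0) = z.1`. -/
def qFun {n m : ℕ} (f : E n × E m → E n) (r : E n × E m → ℝ) (γ L : ℝ) (z : E n × E m) : ℝ :=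
  sSup {J : ℝ | ∃ (a : ℝ → E m) (x : ℝ → E n),
    IsAdmissible L a ∧ a 0 = z.2 ∧ IsTrajectory f a z.1 x ∧ J = reward r γ x a}

/-- `ξ(x₀, a₀; h)`: the state at time `h` of the system started from `x₀` and driven by the
constant action `a₀` (this trajectory exists and is unique when `f` is Lipschitz continuous). -/
def flow {n m : ℕ} (f : E n × E m → E n) (x₀ : E n) (a₀ : E m) (h : ℝ) : E n :=
  Classical.epsilon fun p : E n => ∃ x : ℝ → E n, IsTrajectory f (fun _ => a₀) x₀ x ∧ x h = p

/-- The semi-discrete Bellman operator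
`(T^h q)(x, a) = h r(x, a) + (1 - γ h) sup_{|b| ≤ L} q (ξ(x, a; h), a + h b)`. -/
def bellman {n m : ℕ} (f : E n × E m → E n) (r : E n × E m → ℝ) (γ L h : ℝ)
    (q : E n × E m → ℝ) (z : E n × E m) : ℝ :=
  h * r z + (1 - γ * h) *
    ⨆ b : Metric.closedBall (0 : E m) L, q (flow f z.1 z.2 h, z.2 + h • (b : E m))

/-- Hamilton-Jacobi Q-learning with sampling interval `h`, learning rates `α` and initial function
`q₀`: `Q_{k+1} = (1 - α_k) Q_k + α_k T^h Q_k`. -/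
def qIter {n m : ℕ} (f : E n × E m → E n) (r : E n × E m → ℝ) (γ L h : ℝ) (α : ℕ → ℝ)
    (q₀ : E n × E m → ℝ) : ℕ → E n × E m → ℝ
  | 0 => q₀
  | k + 1 => fun z =>
      (1 - α k) * qIter f r γ L h α q₀ k z + α k * bellman f r γ L h (qIter f r γ L h α q₀ k) z

end HJQ

end

namespace HJQ

/-! For fixed small `h` the Bellman operator is a `(1 - γ h)`-contraction in the sup norm. Its fixed
point is the value `discreteValue` of a control problem with time step `h`
(`bellman_discreteValue`). A learning step with rate `α k` therefore shrinks the distance to this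
fixed point by the factor `1 - γ h α k ≤ exp (-γ h α k)`, and the error after `k` steps is governed
by `h ∑ α τ` (`abs_qIter_sub_le`).

It remains to compare the discrete value with `qFun`, uniformly in the starting point
(`abs_discreteValue_sub_qFun_le`). Integrating a velocity sequence gives an admissible control, and
sampling an admissible control at the times `k h` gives a velocity sequence; in both directions the
actions agree at the nodes. Gronwall's inequality bounds the gap between the states by `O(h)` on
bounded time intervals. The discrete reward is written as an integral over the same half-line, so
the rewards differ by at most the integral of `discrepancy`, which tends to `0` by dominated
convergence. -/

/-! ### Trajectories of the state equation -/

lemma lipschitzWith_slice {n m : ℕ} {f : E n × E m → E n} {K : ℝ≥0} (hK : LipschitzWith K f)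
    (a : E m) : LipschitzWith K fun p : E n => f (p, a) := by
  have := hK.comp (LipschitzWith.prodMk_right (α := E n) a)
  rwa [mul_one] at this

/-- Two solutions of the same Lipschitz state equation on `[0, T]` agree there. -/
lemma eqOn_Icc_of_hasDerivWithinAt {n m : ℕ} {f : E n × E m → E n} {K : ℝ≥0}
    (hK : LipschitzWith K f) {a : ℝ → E m} {x y : ℝ → E n} {S T U : ℝ} (hS : U ≤ S) (hT : U ≤ T)
    (hx : ∀ t ∈ Icc 0 S, HasDerivWithinAt x (f (x t, a t)) (Icc 0 S) t)
    (hy : ∀ t ∈ Icc 0 T, HasDerivWithinAt y (f (y t, a t)) (Icc 0 T) t)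
    (h0 : x 0 = y 0) : EqOn x y (Icc 0 U) := by
  have key : ∀ (z : ℝ → E n) (R : ℝ), U ≤ R →
      (∀ t ∈ Icc 0 R, HasDerivWithinAt z (f (z t, a t)) (Icc 0 R) t) →
      ContinuousOn z (Icc 0 U) ∧
        ∀ t ∈ Ico 0 U, HasDerivWithinAt z (f (z t, a t)) (Ici t) t := by
    intro z R hR hz
    refine ⟨fun t ht => ((hz t ⟨ht.1, ht.2.trans hR⟩).continuousWithinAt).mono
      (Icc_subset_Icc_right hR), fun t ht => ?_⟩
    refine (hz t ⟨ht.1, ht.2.le.trans hR⟩).mono_of_mem_nhdsWithin ?_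
    filter_upwards [Ico_mem_nhdsGE (ht.2.trans_le hR)] with s hs using ⟨ht.1.trans hs.1, hs.2.le⟩
  obtain ⟨hxc, hxd⟩ := key x S hS hx
  obtain ⟨hyc, hyd⟩ := key y T hT hy
  have hv : ∀ t, LipschitzWith K fun p : E n => f (p, a t) :=
    fun t => lipschitzWith_slice hK (a t)
  exact ODE_solution_unique (v := fun t p => f (p, a t)) hv hxc hxd hyc hyd h0

/-- A bounded Lipschitz state equation driven by a continuous control has a solution
on `[0, T]`. -/
lemma exists_solution_Icc {n m : ℕ} {f : E n × E m → E n} {K C : ℝ≥0}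
    (hK : LipschitzWith K f) (hC : ∀ z, ‖f z‖ ≤ C) {a : ℝ → E m} (ha : ContinuousOn a (Ici 0))
    (x₀ : E n) {T : ℝ} (hT : 0 ≤ T) :
    ∃ x : ℝ → E n, x 0 = x₀ ∧
      ∀ t ∈ Icc 0 T, HasDerivWithinAt x (f (x t, a t)) (Icc 0 T) t := by
  -- With speed at most `C` the solution stays in the ball of radius `C * T` up to time `T`, so the
  -- local existence theorem covers all of `[0, T]`.
  have hpl : IsPicardLindelof (fun t p => f (p, a t)) (tmin := 0) (tmax := T)
      ⟨0, left_mem_Icc.2 hT⟩ x₀ (C * T.toNNReal) 0 C K :=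
    { lipschitzOnWith := fun t _ => (lipschitzWith_slice hK (a t)).lipschitzOnWith
      continuousOn := fun p _ => hK.continuous.comp_continuousOn
        (continuousOn_const.prodMk (ha.mono fun t ht => ht.1))
      norm_le := fun t _ p _ => hC _
      mul_max_le := by simp [hT] }
  exact hpl.exists_eq_forall_mem_Icc_hasDerivWithinAt₀

/-- Solutions on the intervals `[0, N]` agree where they overlap, by uniqueness, so they glue to one
on `[0, ∞)`. -/
lemma exists_isTrajectory {n m : ℕ} {f : E n × E m → E n} (hf : BoundedLipschitz f)
    {a : ℝ → E m} (ha : ContinuousOn a (Ici 0)) (x₀ : E n) : ∃ x, IsTrajectory f a x₀ x := by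
  obtain ⟨⟨C, hC⟩, K, hK⟩ := hf
  have hC' : ∀ z, ‖f z‖ ≤ C.toNNReal := fun z => (hC z).trans (Real.le_coe_toNNReal C)
  choose y hy0 hy using fun N : ℕ => exists_solution_Icc hK hC' ha x₀ (Nat.cast_nonneg (α := ℝ) N)
  refine ⟨fun t => y (⌊t⌋₊ + 1) t, hy0 _, fun t ht => ?_⟩
  have ht0 : (0 : ℝ) ≤ t := ht
  have htN : t < ((⌊t⌋₊ + 2 : ℕ) : ℝ) := by
    push_cast; linarith [Nat.lt_floor_add_one t]
  have heq : ∀ s ∈ Ico (0 : ℝ) ((⌊t⌋₊ + 2 : ℕ) : ℝ), y (⌊s⌋₊ + 1) s = y (⌊t⌋₊ + 2) s := by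
    intro s hs
    have hfl : ⌊s⌋₊ + 1 ≤ ⌊t⌋₊ + 2 := (Nat.floor_lt hs.1).2 hs.2
    refine eqOn_Icc_of_hasDerivWithinAt hK le_rfl (Nat.cast_le.2 hfl) (hy _) (hy _)
      ((hy0 _).trans (hy0 _).symm) ⟨hs.1, ?_⟩
    push_cast; exact (Nat.lt_floor_add_one s).le
  have hd := hy (⌊t⌋₊ + 2) t ⟨ht0, htN.le⟩
  have hmem : Ico (0 : ℝ) ((⌊t⌋₊ + 2 : ℕ) : ℝ) ∈ 𝓝[Ici 0] t := by
    rw [← Ici_inter_Iio]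
    exact inter_mem self_mem_nhdsWithin (mem_nhdsWithin_of_mem_nhds (Iio_mem_nhds htN))
  have hd' := hd.mono_of_mem_nhdsWithin (mem_of_superset hmem Ico_subset_Icc_self)
  have hval := heq t ⟨ht0, htN⟩
  rw [← hval] at hd'
  exact hd'.congr_of_eventuallyEq (by filter_upwards [hmem] with s hs using heq s hs) hval

lemma IsTrajectory.hasDerivWithinAt_Ici {n m : ℕ} {f : E n × E m → E n} {a : ℝ → E m} {x₀ : E n}
    {x : ℝ → E n} (hx : IsTrajectory f a x₀ x) {t : ℝ} (ht : 0 ≤ t) :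
    HasDerivWithinAt x (f (x t, a t)) (Ici t) t :=
  (hx.2 t ht).mono (Ici_subset_Ici.2 ht)

lemma IsTrajectory.continuousOn {n m : ℕ} {f : E n × E m → E n} {a : ℝ → E m} {x₀ : E n}
    {x : ℝ → E n} (hx : IsTrajectory f a x₀ x) : ContinuousOn x (Ici 0) :=
  fun t ht => (hx.2 t ht).continuousWithinAt

/-- The flow is attained by an actual trajectory. -/
lemma exists_isTrajectory_flow {n m : ℕ} {f : E n × E m → E n} (hf : BoundedLipschitz f)
    (x₀ : E n) (a₀ : E m) (h : ℝ) :
    ∃ x, IsTrajectory f (fun _ => a₀) x₀ x ∧ x h = flow f x₀ a₀ h := by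
  obtain ⟨x, hx⟩ := exists_isTrajectory hf (a := fun _ => a₀) continuousOn_const x₀
  exact Classical.epsilon_spec
    (p := fun p : E n => ∃ x : ℝ → E n, IsTrajectory f (fun _ => a₀) x₀ x ∧ x h = p)
    ⟨x h, x, hx, rfl⟩

/-- Trajectories move with speed at most `C`. -/
lemma IsTrajectory.norm_sub_le {n m : ℕ} {f : E n × E m → E n} {C : ℝ} (hC : ∀ z, ‖f z‖ ≤ C)
    {a : ℝ → E m} {x₀ : E n} {x : ℝ → E n} (hx : IsTrajectory f a x₀ x) {s t : ℝ} (hs : 0 ≤ s)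
    (hst : s ≤ t) : ‖x t - x s‖ ≤ C * (t - s) :=
  norm_image_sub_le_of_norm_deriv_right_le_segment
    (hx.continuousOn.mono fun _ hu => hs.trans hu.1)
    (fun _ hu => hx.hasDerivWithinAt_Ici (hs.trans hu.1)) (fun _ _ => hC _) t ⟨hst, le_rfl⟩

/-- One step of the comparison between a trajectory and the flow with frozen action. -/
lemma IsTrajectory.dist_flow_le {n m : ℕ} {f : E n × E m → E n} (hf : BoundedLipschitz f)
    {K : ℝ≥0} (hK : LipschitzWith K f) {L : ℝ} (hL : 0 ≤ L)
    {a : ℝ → E m} (ha : ∀ s t, 0 ≤ s → s ≤ t → ‖a t - a s‖ ≤ L * (t - s)) {x₀ : E n}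
    {x : ℝ → E n} (hx : IsTrajectory f a x₀ x) {s h δ : ℝ} (hs : 0 ≤ s) (hh : 0 ≤ h) {p : E n}
    (hp : dist (x s) p ≤ δ) :
    dist (x (s + h)) (flow f p (a s) h) ≤ gronwallBound δ K (K * (L * h)) h := by
  obtain ⟨y, hy, hyh⟩ := exists_isTrajectory_flow hf p (a s) h
  have hv : ∀ _ : ℝ, LipschitzWith K fun q : E n => f (q, a s) :=
    fun _ => lipschitzWith_slice hK (a s)
  -- The trajectory solves the frozen equation up to the error `K * (L * h)`, because the action
  -- moves by at most `L * h` during the step.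
  have key := dist_le_of_approx_trajectories_ODE (v := fun _ q => f (q, a s))
    (f := fun t => x (s + t)) (g := y) (f' := fun t => f (x (s + t), a (s + t)))
    (g' := fun t => f (y t, a s)) (εf := K * (L * h)) (εg := 0) (a := 0) (b := h) (δ := δ) hv
    (hx.continuousOn.comp (by fun_prop) fun t ht => add_nonneg hs ht.1)
    (fun t ht => by
      have h1 := hx.hasDerivWithinAt_Ici (add_nonneg hs ht.1)
      have h2 := h1.scomp t ((hasDerivWithinAt_id t (Ici t)).const_add s)
        fun u hu => add_le_add_right (show t ≤ u from hu) s
      simpa [Function.comp_def] using h2)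
    (fun t ht => by
      refine (hK.dist_le_mul _ _).trans (mul_le_mul_of_nonneg_left ?_ K.2)
      have h2 := ha s (s + t) hs (by linarith [ht.1])
      rw [Prod.dist_eq, dist_self, max_eq_right dist_nonneg, dist_eq_norm]
      refine h2.trans (mul_le_mul_of_nonneg_left (by linarith [ht.2]) hL))
    (hy.continuousOn.mono fun t ht => ht.1)
    (fun t ht => hy.hasDerivWithinAt_Ici ht.1) (fun t _ => by simp)
    (by simpa [hy.1] using hp) h ⟨hh, le_rfl⟩
  simpa [hyh] using key

/-! ### Admissible controls and piecewise constant velocities -/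

/-- An admissible control is `L`-Lipschitz on `[0, ∞)`. -/
lemma IsAdmissible.norm_sub_le {m : ℕ} {L : ℝ} {a : ℝ → E m} (ha : IsAdmissible L a) {s t : ℝ}
    (hs : 0 ≤ s) (hst : s ≤ t) : ‖a t - a s‖ ≤ L * (t - s) := by
  obtain ⟨⟨C, hC⟩, hd⟩ := ha
  -- Pairing with the increment `v` itself reduces to a real absolutely continuous function; its
  -- integrated derivative gives `‖v‖ ^ 2 ≤ ‖v‖ * L * (t - s)`.
  set v := a t - a s with hv
  have hsub : uIcc s t ⊆ Ici 0 := by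
    rw [uIcc_of_le hst]; exact fun u hu => hs.trans hu.1
  have hg : AbsolutelyContinuousOnInterval (fun u => inner ℝ v (a u)) s t :=
    ((innerSL ℝ v).lipschitz.comp_lipschitzOnWith
      (hC.mono hsub)).absolutelyContinuousOnInterval
  have hint := hg.integral_deriv_eq_sub
  have hdiff : ∀ᵐ u : ℝ, u ∈ Ioi (0 : ℝ) → DifferentiableAt ℝ a u := by
    filter_upwards [hC.ae_differentiableWithinAt_of_mem] with u hu hu0
    exact (hu (mem_Ici_of_Ioi hu0)).differentiableAt (Ici_mem_nhds hu0)
  have hbound : ∀ᵐ u : ℝ, u ∈ uIoc s t → ‖deriv (fun u => inner ℝ v (a u)) u‖ ≤ ‖v‖ * L := by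
    filter_upwards [hdiff, (ae_restrict_iff' measurableSet_Ioi).1 hd] with u h1 h2 hu
    rw [uIoc_of_le hst] at hu
    have hu0 : u ∈ Ioi (0 : ℝ) := lt_of_le_of_lt hs hu.1
    have h3 : deriv (fun u => inner ℝ v (a u)) u = inner ℝ v (deriv a u) :=
      (((innerSL ℝ v).hasFDerivAt.comp_hasDerivAt u (h1 hu0).hasDerivAt)).deriv
    rw [h3]
    exact (norm_inner_le_norm _ _).trans (mul_le_mul_of_nonneg_left (h2 hu0) (norm_nonneg _))
  have hle := intervalIntegral.norm_integral_le_of_norm_le_const_ae hbound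
  rw [hint, ← inner_sub_right, ← hv, real_inner_self_eq_norm_sq, abs_of_nonneg (sub_nonneg.2 hst),
    Real.norm_of_nonneg (sq_nonneg _)] at hle
  rcases (norm_nonneg v).eq_or_lt with h0 | h0
  -- The sign of `L` is not given; it follows from the derivative bound at a single point.
  · have hL : 0 ≤ L * (t - s) := by
      rcases hst.eq_or_lt with rfl | hlt
      · simp
      have hne : (volume.restrict (Ioi (0 : ℝ))) ≠ 0 := by simp
      have : (ae (volume.restrict (Ioi (0 : ℝ)))).NeBot := ae_neBot.2 hne
      obtain ⟨u, hu⟩ := hd.exists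
      exact mul_nonneg ((norm_nonneg _).trans hu) (sub_nonneg.2 hst)
    rwa [← h0]
  · nlinarith

/-- The control with velocity `b k` on `[k h, (k + 1) h)` starting from `a₀`. -/
noncomputable def stepControl {m : ℕ} (h : ℝ) (b : ℕ → E m) (a₀ : E m) (t : ℝ) : E m :=
  a₀ + ∫ s in (0 : ℝ)..t, b ⌊s / h⌋₊

lemma measurable_comp_floor_div {β : Type*} [MeasurableSpace β] (h : ℝ) (b : ℕ → β) :
    Measurable fun s : ℝ => b ⌊s / h⌋₊ :=
  (measurable_from_top (f := b)).comp (Nat.measurable_floor.comp (measurable_id.div_const h))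

lemma intervalIntegrable_comp_floor_div {m : ℕ} {L : ℝ} {b : ℕ → E m} (hb : ∀ k, ‖b k‖ ≤ L)
    (h s t : ℝ) : IntervalIntegrable (fun u => b ⌊u / h⌋₊) volume s t :=
  (intervalIntegrable_const (c := L)).mono_fun
    (measurable_comp_floor_div h b).aestronglyMeasurable
    (Eventually.of_forall fun _ => (hb _).trans (le_abs_self L))

lemma stepControl_sub {m : ℕ} {L : ℝ} {b : ℕ → E m} (hb : ∀ k, ‖b k‖ ≤ L) (h : ℝ) (a₀ : E m)
    (s t : ℝ) : stepControl h b a₀ t - stepControl h b a₀ s = ∫ u in s..t, b ⌊u / h⌋₊ := by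
  rw [stepControl, stepControl, add_sub_add_left_eq_sub,
    intervalIntegral.integral_interval_sub_left (intervalIntegrable_comp_floor_div hb h _ _)
      (intervalIntegrable_comp_floor_div hb h _ _)]

lemma lipschitzWith_stepControl {m : ℕ} {L : ℝ} (hL : 0 ≤ L) {b : ℕ → E m} (hb : ∀ k, ‖b k‖ ≤ L)
    (h : ℝ) (a₀ : E m) : LipschitzWith L.toNNReal (stepControl h b a₀) := by
  refine LipschitzWith.of_dist_le_mul fun t s => ?_
  rw [dist_eq_norm, stepControl_sub hb, Real.coe_toNNReal L hL, Real.dist_eq]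
  exact intervalIntegral.norm_integral_le_of_norm_le_const fun _ _ => hb _

lemma isAdmissible_stepControl {m : ℕ} {L : ℝ} (hL : 0 ≤ L) {b : ℕ → E m}
    (hb : ∀ k, ‖b k‖ ≤ L) (h : ℝ) (a₀ : E m) : IsAdmissible L (stepControl h b a₀) := by
  have hlip := lipschitzWith_stepControl hL hb h a₀
  refine ⟨⟨_, hlip.lipschitzOnWith⟩, Eventually.of_forall fun t => ?_⟩
  simpa [hL] using norm_deriv_le_of_lipschitz (x₀ := t) hlip

lemma floor_div_eq {h t : ℝ} (hh : 0 < h) {k : ℕ} (h1 : k * h ≤ t) (h2 : t < (k + 1) * h) :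
    ⌊t / h⌋₊ = k := by
  rw [Nat.floor_eq_iff (div_nonneg ((by positivity : (0 : ℝ) ≤ k * h).trans h1) hh.le)]
  exact ⟨(le_div_iff₀ hh).2 h1, (div_lt_iff₀ hh).2 h2⟩

lemma stepControl_succ {m : ℕ} {L : ℝ} {b : ℕ → E m} (hb : ∀ k, ‖b k‖ ≤ L) {h : ℝ} (hh : 0 < h)
    (a₀ : E m) (k : ℕ) :
    stepControl h b a₀ ((k + 1 : ℕ) * h) = stepControl h b a₀ (k * h) + h • b k := by
  rw [← sub_eq_iff_eq_add', stepControl_sub hb,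
    intervalIntegral.integral_congr_Ioo_of_le (g := fun _ => b k)]
  · rw [intervalIntegral.integral_const]; congr 1; push_cast; ring
  · push_cast; nlinarith
  · intro u hu
    exact congrArg b (floor_div_eq hh hu.1.le (by simpa using hu.2))

/-! ### Discount factors and the discrepancy integral -/

/-- The power is the exponential of `(⌊t / h⌋₊ * h) * (h⁻¹ * log (1 - γ h))`. The first factor tends
to `t`; the second is a difference quotient at `0` and tends to `-γ`. -/
lemma tendsto_one_sub_mul_pow_floor (γ : ℝ) {t : ℝ} (ht : 0 ≤ t) :
    Tendsto (fun h : ℝ => (1 - γ * h) ^ ⌊t / h⌋₊) (𝓝[>] 0) (𝓝 (Real.exp (-γ * t))) := by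
  have h1 : Tendsto (fun h : ℝ => (⌊t / h⌋₊ : ℝ) * h) (𝓝[>] 0) (𝓝 t) := by
    have := (tendsto_nat_floor_mul_div_atTop ht).comp (tendsto_inv_nhdsGT_zero (𝕜 := ℝ))
    simpa [Function.comp_def, div_eq_mul_inv] using this
  have h2 : Tendsto (fun h : ℝ => h⁻¹ * Real.log (1 - γ * h)) (𝓝[>] 0) (𝓝 (-γ)) := by
    have hd : HasDerivAt (fun h : ℝ => Real.log (1 - γ * h)) (-γ) 0 := by
      have h3 : HasDerivAt (fun h : ℝ => 1 - γ * h) (-γ) 0 := by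
        simpa using ((hasDerivAt_id (0 : ℝ)).const_mul γ).const_sub 1
      simpa using h3.log (by simp)
    have := hd.tendsto_slope_zero_right
    simpa using this
  have h4 := (Real.continuous_exp.tendsto _).comp (h1.mul h2)
  rw [show t * -γ = -γ * t by ring] at h4
  have hpos : ∀ᶠ h : ℝ in 𝓝[>] 0, 0 < 1 - γ * h := by
    have : Tendsto (fun h : ℝ => 1 - γ * h) (𝓝 0) (𝓝 1) := by
      simpa using (Continuous.tendsto (f := fun h : ℝ => 1 - γ * h) (by fun_prop) 0)
    exact (this.eventually_const_lt one_pos).filter_mono nhdsWithin_le_nhds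
  refine h4.congr' ?_
  filter_upwards [hpos, self_mem_nhdsWithin] with h hp hh
  have hh0 : (0 : ℝ) < h := hh
  rw [Function.comp_apply, mul_assoc, mul_inv_cancel_left₀ hh0.ne', mul_comm,
    ← Real.rpow_def_of_pos hp, Real.rpow_natCast]

/-- From `1 - γ h ≤ exp (-γ h)`; rounding `t / h` down costs at most `exp (γ h) ≤ exp γ`. The bound
is uniform in `h` and supplies the integrable majorants. -/
lemma one_sub_mul_pow_floor_le {γ h t : ℝ} (hγ : 0 < γ) (hh : 0 < h) (h1 : h ≤ 1)
    (hγh : γ * h ≤ 1) :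
    (1 - γ * h) ^ ⌊t / h⌋₊ ≤ Real.exp γ * Real.exp (-γ * t) := by
  have hfl : t / h < ⌊t / h⌋₊ + 1 := Nat.lt_floor_add_one _
  rw [div_lt_iff₀ hh] at hfl
  calc (1 - γ * h) ^ ⌊t / h⌋₊ ≤ Real.exp (-(γ * h)) ^ ⌊t / h⌋₊ :=
        pow_le_pow_left₀ (by linarith) (Real.one_sub_le_exp_neg _) _
    _ = Real.exp (⌊t / h⌋₊ * -(γ * h)) := (Real.exp_nat_mul _ _).symm
    _ ≤ Real.exp (γ + -γ * t) := by
        refine Real.exp_le_exp.2 ?_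
        nlinarith [mul_lt_mul_of_pos_left hfl hγ, mul_le_mul_of_nonneg_left h1 hγ.le]
    _ = _ := Real.exp_add _ _

/-- A pointwise bound for the difference of the continuous-time and discrete-time discounted
rewards: `C` bounds the running reward, `D` is its Lipschitz constant, and the states differ by at
most `h (A + L e^{K t})`. -/
noncomputable def discrepancy (C D A L K γ h t : ℝ) : ℝ :=
  C * |Real.exp (-γ * t) - (1 - γ * h) ^ ⌊t / h⌋₊| +
    (1 - γ * h) ^ ⌊t / h⌋₊ * min (2 * C) (D * (h * (A + L * Real.exp (K * t))))

lemma measurable_discrepancy (C D A L K γ h : ℝ) : Measurable (discrepancy C D A L K γ h) := by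
  have := measurable_comp_floor_div h fun k => (1 - γ * h) ^ k
  unfold discrepancy
  fun_prop

lemma norm_discrepancy_le {C D A L K γ h t : ℝ} (hC : 0 ≤ C) (hD : 0 ≤ D) (hA : 0 ≤ A)
    (hL : 0 ≤ L) (hγ : 0 < γ) (hh : 0 < h) (h1 : h ≤ 1) (hγh : γ * h ≤ 1) :
    ‖discrepancy C D A L K γ h t‖ ≤ (C + 3 * C * Real.exp γ) * Real.exp (-γ * t) := by
  have hp := one_sub_mul_pow_floor_le (t := t) hγ hh h1 hγh
  have hp0 : 0 ≤ (1 - γ * h) ^ ⌊t / h⌋₊ := pow_nonneg (by linarith) _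
  have he := Real.exp_pos (-γ * t)
  have hmin : 0 ≤ min (2 * C) (D * (h * (A + L * Real.exp (K * t)))) := by positivity
  unfold discrepancy
  rw [Real.norm_of_nonneg (by positivity)]
  have habs : |Real.exp (-γ * t) - (1 - γ * h) ^ ⌊t / h⌋₊| ≤
      Real.exp (-γ * t) + Real.exp γ * Real.exp (-γ * t) := by
    rw [abs_le]; constructor <;> linarith
  have h2 := mul_le_mul_of_nonneg_left habs hC
  have h3 : (1 - γ * h) ^ ⌊t / h⌋₊ * min (2 * C) (D * (h * (A + L * Real.exp (K * t)))) ≤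
      Real.exp γ * Real.exp (-γ * t) * (2 * C) :=
    mul_le_mul hp (min_le_left _ _) hmin (by positivity)
  linarith

lemma eventually_small_step (γ : ℝ) :
    ∀ᶠ h : ℝ in 𝓝[>] 0, 0 < h ∧ h ≤ 1 ∧ γ * h < 1 := by
  have h1 : ∀ᶠ h : ℝ in 𝓝 0, γ * h < 1 :=
    (Continuous.tendsto (f := fun h : ℝ => γ * h) (by fun_prop) 0).eventually_lt_const (by simp)
  have h2 : ∀ᶠ h : ℝ in 𝓝 0, h ≤ 1 := eventually_le_nhds one_pos
  filter_upwards [self_mem_nhdsWithin, h1.filter_mono nhdsWithin_le_nhds,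
    h2.filter_mono nhdsWithin_le_nhds] with h a b c using ⟨a, c, b⟩

lemma integrableOn_exp_neg_mul {γ : ℝ} (hγ : 0 < γ) (c : ℝ) :
    IntegrableOn (fun t : ℝ => c * Real.exp (-γ * t)) (Ioi 0) :=
  (integrableOn_exp_mul_Ioi (neg_lt_zero.2 hγ) 0).const_mul c

lemma integrableOn_of_norm_le_exp {γ c : ℝ} (hγ : 0 < γ) {g : ℝ → ℝ}
    (hm : AEStronglyMeasurable g (volume.restrict (Ioi (0 : ℝ))))
    (hg : ∀ t, 0 < t → ‖g t‖ ≤ c * Real.exp (-γ * t)) : IntegrableOn g (Ioi 0) :=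
  (integrableOn_exp_neg_mul hγ c).mono' hm
    ((ae_restrict_iff' measurableSet_Ioi).2 (Eventually.of_forall hg))

/-- The Gronwall factor `exp (K t)` may outgrow the discount. The Lipschitz term in the minimum
serves only for the pointwise limit; the cap `2 * C` gives the majorant. -/
lemma tendsto_integral_discrepancy {C D A L γ : ℝ} (K : ℝ) (hC : 0 ≤ C) (hD : 0 ≤ D) (hA : 0 ≤ A)
    (hL : 0 ≤ L) (hγ : 0 < γ) :
    Tendsto (fun h => ∫ t in Ioi (0 : ℝ), discrepancy C D A L K γ h t) (𝓝[>] 0) (𝓝 0) := by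
  have key := tendsto_integral_filter_of_dominated_convergence
    (μ := volume.restrict (Ioi (0 : ℝ))) (l := 𝓝[>] (0 : ℝ)) (F := discrepancy C D A L K γ)
    (f := fun _ => (0 : ℝ)) (fun t => (C + 3 * C * Real.exp γ) * Real.exp (-γ * t))
    (Eventually.of_forall fun h => (measurable_discrepancy C D A L K γ h).aestronglyMeasurable)
    ?_ (integrableOn_exp_neg_mul hγ _) ?_
  · simpa using key
  · filter_upwards [eventually_small_step γ] with h hh
    exact Eventually.of_forall fun t =>
      norm_discrepancy_le hC hD hA hL hγ hh.1 hh.2.1 hh.2.2.le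
  · rw [ae_restrict_iff' measurableSet_Ioi]
    refine Eventually.of_forall fun t ht => ?_
    have hp := tendsto_one_sub_mul_pow_floor γ (le_of_lt ht)
    have h1 : Tendsto (fun h : ℝ => D * (h * (A + L * Real.exp (K * t)))) (𝓝[>] 0) (𝓝 0) := by
      have := Continuous.tendsto (f := fun h : ℝ => D * (h * (A + L * Real.exp (K * t))))
        (by fun_prop) 0
      simp only [zero_mul, mul_zero] at this
      exact this.mono_left nhdsWithin_le_nhds
    have h2 := ((hp.const_sub (Real.exp (-γ * t))).abs.const_mul C).add
      (hp.mul (tendsto_const_nhds (x := 2 * C) |>.min h1))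
    simpa [discrepancy, hC] using h2

/-! ### Discrete paths and comparison of rewards -/

/-- The state-action path of the discrete-time system with velocities `b`. -/
noncomputable def discretePath {n m : ℕ} (f : E n × E m → E n) (h : ℝ) (b : ℕ → E m)
    (z : E n × E m) : ℕ → E n × E m
  | 0 => z
  | k + 1 => (flow f (discretePath f h b z k).1 (discretePath f h b z k).2 h,
      (discretePath f h b z k).2 + h • b k)

/-- The discounted reward `∑ₖ h (1 - γ h)ᵏ r(pₖ)` of a discrete path, as an integral. -/
noncomputable def discreteReward {n m : ℕ} (r : E n × E m → ℝ) (γ h : ℝ) (p : ℕ → E n × E m) : ℝ :=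
  ∫ t in Ioi (0 : ℝ), (1 - γ * h) ^ ⌊t / h⌋₊ * r (p ⌊t / h⌋₊)

lemma integrableOn_discreteReward {n m : ℕ} {r : E n × E m → ℝ} {C γ h : ℝ}
    (hC : ∀ z, ‖r z‖ ≤ C) (hγ : 0 < γ) (hh : 0 < h) (h1 : h ≤ 1) (hγh : γ * h ≤ 1)
    (p : ℕ → E n × E m) :
    IntegrableOn (fun t : ℝ => (1 - γ * h) ^ ⌊t / h⌋₊ * r (p ⌊t / h⌋₊)) (Ioi 0) := by
  refine integrableOn_of_norm_le_exp (c := Real.exp γ * C) hγ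
    (measurable_comp_floor_div h fun k => (1 - γ * h) ^ k * r (p k)).aestronglyMeasurable
    fun t _ => ?_
  have hp0 : 0 ≤ (1 - γ * h) ^ ⌊t / h⌋₊ := pow_nonneg (by linarith) _
  rw [norm_mul, Real.norm_of_nonneg hp0, mul_right_comm]
  exact mul_le_mul (one_sub_mul_pow_floor_le hγ hh h1 hγh) (hC _) (norm_nonneg _)
    (by positivity)

lemma integrableOn_reward {n m : ℕ} {f : E n × E m → E n} {r : E n × E m → ℝ} {C γ : ℝ}
    (hC : ∀ z, ‖r z‖ ≤ C) (hr : Continuous r) (hγ : 0 < γ) {a : ℝ → E m}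
    (ha : ContinuousOn a (Ici 0)) {x₀ : E n} {x : ℝ → E n} (hx : IsTrajectory f a x₀ x) :
    IntegrableOn (fun t : ℝ => Real.exp (-γ * t) * r (x t, a t)) (Ioi 0) := by
  refine integrableOn_of_norm_le_exp (c := C) hγ (ContinuousOn.aestronglyMeasurable
    (ContinuousOn.mul (by fun_prop) (hr.comp_continuousOn
      ((hx.continuousOn.prodMk ha).mono Ioi_subset_Ici_self))) measurableSet_Ioi) fun t _ => ?_
  rw [norm_mul, Real.norm_of_nonneg (Real.exp_pos _).le, mul_comm]
  exact mul_le_mul_of_nonneg_right (hC _) (Real.exp_pos _).le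

lemma abs_reward_le {n m : ℕ} {r : E n × E m → ℝ} {C γ : ℝ}
    (hC : ∀ z, ‖r z‖ ≤ C) (hγ : 0 < γ) (x : ℝ → E n) (a : ℝ → E m) :
    |reward r γ x a| ≤ ∫ t in Ioi (0 : ℝ), C * Real.exp (-γ * t) := by
  rw [reward, ← Real.norm_eq_abs]
  refine norm_integral_le_of_norm_le (integrableOn_exp_neg_mul hγ C)
    (Eventually.of_forall fun t => ?_)
  rw [norm_mul, Real.norm_of_nonneg (Real.exp_pos _).le, mul_comm]
  exact mul_le_mul_of_nonneg_right (hC _) (Real.exp_pos _).le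

lemma abs_discreteReward_le {n m : ℕ} {r : E n × E m → ℝ} {C γ h : ℝ}
    (hC : ∀ z, ‖r z‖ ≤ C) (hγ : 0 < γ) (hh : 0 < h) (h1 : h ≤ 1) (hγh : γ * h ≤ 1)
    (p : ℕ → E n × E m) :
    |discreteReward r γ h p| ≤ ∫ t in Ioi (0 : ℝ), Real.exp γ * C * Real.exp (-γ * t) := by
  rw [discreteReward, ← Real.norm_eq_abs]
  refine norm_integral_le_of_norm_le (integrableOn_exp_neg_mul hγ _)
    (Eventually.of_forall fun t => ?_)
  have hp0 : 0 ≤ (1 - γ * h) ^ ⌊t / h⌋₊ := pow_nonneg (by linarith) _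
  rw [norm_mul, Real.norm_of_nonneg hp0, mul_right_comm]
  exact mul_le_mul (one_sub_mul_pow_floor_le hγ hh h1 hγh) (hC _) (norm_nonneg _)
    (by positivity)

/-- The bound solves exactly the recursion `δ ↦ exp (K h) δ + L h (exp (K h) - 1)` that the one-step
Gronwall estimate produces. -/
lemma dist_discretePath_le {n m : ℕ} {f : E n × E m → E n} (hf : BoundedLipschitz f) {K : ℝ≥0}
    (hK : LipschitzWith K f) (hK0 : (K : ℝ) ≠ 0) {L : ℝ} (hL : 0 ≤ L) {a : ℝ → E m}
    (ha : ∀ s t, 0 ≤ s → s ≤ t → ‖a t - a s‖ ≤ L * (t - s)) {x₀ : E n} {x : ℝ → E n}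
    (hx : IsTrajectory f a x₀ x) {h : ℝ} (hh : 0 < h) {p : ℕ → E n × E m} (hp0 : (p 0).1 = x₀)
    (hp : ∀ k, (p (k + 1)).1 = flow f (p k).1 (p k).2 h) (hpa : ∀ k : ℕ, (p k).2 = a (k * h))
    (k : ℕ) : dist (x (k * h)) (p k).1 ≤ L * h * (Real.exp (K * (k * h)) - 1) := by
  induction k with
  | zero => simp [hp0, hx.1]
  | succ k ih =>
    have key := hx.dist_flow_le hf hK hL ha (by positivity : (0 : ℝ) ≤ k * h) hh.le ih
    rw [← hpa, ← hp, gronwallBound_of_K_ne_0 hK0] at key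
    have e1 : ((k + 1 : ℕ) : ℝ) * h = k * h + h := by push_cast; ring
    rw [e1]
    refine key.trans_eq ?_
    rw [mul_add, Real.exp_add]
    field_simp
    ring

lemma abs_reward_sub_discreteReward_le {n m : ℕ} {f : E n × E m → E n} {r : E n × E m → ℝ}
    (hf : BoundedLipschitz f) {A : ℝ} (hA : ∀ z, ‖f z‖ ≤ A) {K : ℝ≥0} (hK : LipschitzWith K f)
    (hK0 : (K : ℝ) ≠ 0) {C : ℝ} (hC : ∀ z, ‖r z‖ ≤ C) {D : ℝ≥0} (hD : LipschitzWith D r)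
    {γ L : ℝ} (hγ : 0 < γ) (hL : 0 ≤ L) {a : ℝ → E m} (hac : ContinuousOn a (Ici 0))
    (ha : ∀ s t, 0 ≤ s → s ≤ t → ‖a t - a s‖ ≤ L * (t - s)) {x₀ : E n} {x : ℝ → E n}
    (hx : IsTrajectory f a x₀ x) {h : ℝ} (hh : 0 < h) (h1 : h ≤ 1) (hγh : γ * h ≤ 1)
    {p : ℕ → E n × E m} (hp0 : (p 0).1 = x₀)
    (hp : ∀ k, (p (k + 1)).1 = flow f (p k).1 (p k).2 h) (hpa : ∀ k : ℕ, (p k).2 = a (k * h)) :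
    |reward r γ x a - discreteReward r γ h p| ≤
      ∫ t in Ioi (0 : ℝ), discrepancy C D A L K γ h t := by
  have hA0 : 0 ≤ A := (norm_nonneg _).trans (hA 0)
  have hC0 : 0 ≤ C := (norm_nonneg _).trans (hC 0)
  unfold reward discreteReward
  rw [← integral_sub (integrableOn_reward hC hD.continuous hγ hac hx)
    (integrableOn_discreteReward hC hγ hh h1 hγh p), ← Real.norm_eq_abs]
  refine norm_integral_le_of_norm_le
    (integrableOn_of_norm_le_exp hγ (measurable_discrepancy C D A L K γ h).aestronglyMeasurable
      fun t _ => norm_discrepancy_le hC0 D.2 hA0 hL hγ hh h1 hγh)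
    ((ae_restrict_iff' measurableSet_Ioi).2 (Eventually.of_forall fun t ht => ?_))
  have ht0 : (0 : ℝ) < t := ht
  set k := ⌊t / h⌋₊ with hk
  have hkt : k * h ≤ t := (le_div_iff₀ hh).1 (Nat.floor_le (by positivity))
  have htk : t < (k + 1) * h := (div_lt_iff₀ hh).1 (Nat.lt_floor_add_one _)
  have hkh : (0 : ℝ) ≤ k * h := by positivity
  have hw : 0 ≤ (1 - γ * h) ^ k := pow_nonneg (by linarith) _
  have hsub : t - k * h ≤ h := by linarith
  have hexp : Real.exp (K * (k * h)) ≤ Real.exp (K * t) :=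
    Real.exp_le_exp.2 (mul_le_mul_of_nonneg_left hkt K.2)
  have hexp1 : 1 ≤ Real.exp (K * t) := Real.one_le_exp (mul_nonneg K.2 ht0.le)
  have hLh : 0 ≤ L * h := by positivity
  have hdx : dist (x t) (p k).1 ≤ h * (A + L * Real.exp (K * t)) := by
    have d1 := dist_discretePath_le hf hK hK0 hL ha hx hh hp0 hp hpa k
    have d2 := hx.norm_sub_le hA hkh hkt
    rw [← dist_eq_norm] at d2
    have d3 := mul_le_mul_of_nonneg_left hsub hA0
    have d4 := mul_le_mul_of_nonneg_left hexp hLh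
    linarith [dist_triangle (x t) (x (k * h)) (p k).1]
  have hda : dist (a t) (p k).2 ≤ h * (A + L * Real.exp (K * t)) := by
    rw [hpa, dist_eq_norm]
    have d1 := ha _ _ hkh hkt
    have d2 := mul_le_mul_of_nonneg_left hsub hL
    have d3 := mul_le_mul_of_nonneg_left hexp1 hLh
    nlinarith [mul_nonneg hh.le hA0]
  have hr1 : |r (x t, a t) - r (p k)| ≤ D * (h * (A + L * Real.exp (K * t))) :=
    (hD.dist_le_mul _ _).trans (mul_le_mul_of_nonneg_left (max_le hdx hda) D.2)
  have hr2 : |r (x t, a t) - r (p k)| ≤ 2 * C := by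
    have := abs_sub (r (x t, a t)) (r (p k))
    have c1 := hC (x t, a t)
    have c2 := hC (p k)
    rw [Real.norm_eq_abs] at c1 c2
    linarith
  -- Separates the error in the discount from the error in the running reward, matching the two
  -- terms of `discrepancy`.
  have e : Real.exp (-γ * t) * r (x t, a t) - (1 - γ * h) ^ k * r (p k) =
      r (x t, a t) * (Real.exp (-γ * t) - (1 - γ * h) ^ k) +
        (1 - γ * h) ^ k * (r (x t, a t) - r (p k)) := by ring
  rw [e, discrepancy, ← hk]
  refine (norm_add_le _ _).trans (add_le_add ?_ ?_)
  · rw [norm_mul, Real.norm_eq_abs (_ - _)]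
    exact mul_le_mul_of_nonneg_right (hC _) (abs_nonneg _)
  · rw [norm_mul, Real.norm_of_nonneg hw]
    exact mul_le_mul_of_nonneg_left (le_min hr2 hr1) hw

/-- Split the integral at `h` and translate the tail: the floor drops by one and a factor `1 - γ h`
comes out. -/
lemma discreteReward_eq_add {n m : ℕ} {r : E n × E m → ℝ} {C γ h : ℝ}
    (hC : ∀ z, ‖r z‖ ≤ C) (hγ : 0 < γ) (hh : 0 < h) (h1 : h ≤ 1) (hγh : γ * h ≤ 1)
    (p : ℕ → E n × E m) :
    discreteReward r γ h p =
      h * r (p 0) + (1 - γ * h) * discreteReward r γ h fun k => p (k + 1) := by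
  have hint := integrableOn_discreteReward hC hγ hh h1 hγh p
  unfold discreteReward
  rw [← intervalIntegral.integral_interval_add_Ioi (b := h) hint
    (hint.mono_set (Ioi_subset_Ioi hh.le))]
  congr 1
  · rw [intervalIntegral.integral_congr_Ioo_of_le (g := fun _ => r (p 0)) hh.le]
    · simp
    · intro t ht
      have : ⌊t / h⌋₊ = 0 := floor_div_eq hh (by simpa using ht.1.le) (by simpa using ht.2)
      simp [this]
  · have hpre : (fun t : ℝ => t + h) ⁻¹' Ioi h = Ioi 0 := by ext t; simp
    rw [← (measurePreserving_add_right volume h).setIntegral_preimage_emb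
      (measurableEmbedding_addRight h), hpre, ← integral_const_mul]
    refine setIntegral_congr_fun measurableSet_Ioi fun t ht => ?_
    have ht0 : (0 : ℝ) ≤ t / h := div_nonneg (le_of_lt ht) hh.le
    simp only [add_div, div_self hh.ne', Nat.floor_add_one ht0, pow_succ]
    ring

/-- The recursion appends steps at the end, whereas dynamic programming needs the first step peeled
off. -/
lemma discretePath_succ_eq {n m : ℕ} (f : E n × E m → E n) (h : ℝ) (b : ℕ → E m)
    (z : E n × E m) (k : ℕ) :
    discretePath f h b z (k + 1) =
      discretePath f h (fun j => b (j + 1)) (flow f z.1 z.2 h, z.2 + h • b 0) k := by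
  induction k with
  | zero => rfl
  | succ k ih => rw [discretePath, ih]; rfl

/-! ### The discrete value function and contraction of the iteration -/

/-- The optimal value of the discrete-time problem. -/
noncomputable def discreteValue {n m : ℕ} (f : E n × E m → E n) (r : E n × E m → ℝ) (γ L h : ℝ)
    (z : E n × E m) : ℝ :=
  ⨆ b : ℕ → Metric.closedBall (0 : E m) L,
    discreteReward r γ h (discretePath f h (fun k => (b k : E m)) z)

lemma bddAbove_range_of_abs_le {ι : Sort*} {u : ι → ℝ} {B : ℝ} (hu : ∀ i, |u i| ≤ B) :
    BddAbove (range u) :=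
  ⟨B, forall_mem_range.2 fun i => (abs_le.1 (hu i)).2⟩

lemma abs_ciSup_le {ι : Sort*} [Nonempty ι] {u : ι → ℝ} {B : ℝ} (hu : ∀ i, |u i| ≤ B) :
    |⨆ i, u i| ≤ B := by
  obtain ⟨i⟩ := ‹Nonempty ι›
  exact abs_le.2 ⟨(abs_le.1 (hu i)).1.trans (le_ciSup (bddAbove_range_of_abs_le hu) i),
    ciSup_le fun j => (abs_le.1 (hu j)).2⟩

lemma abs_ciSup_sub_ciSup_le {ι : Sort*} [Nonempty ι] {u v : ι → ℝ} {B : ℝ}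
    (hu : BddAbove (range u)) (hv : BddAbove (range v)) (huv : ∀ i, |u i - v i| ≤ B) :
    |(⨆ i, u i) - ⨆ i, v i| ≤ B := by
  have h1 : (⨆ i, u i) ≤ (⨆ i, v i) + B := ciSup_le fun i => by
    linarith [(abs_le.1 (huv i)).2, le_ciSup hv i]
  have h2 : (⨆ i, v i) ≤ (⨆ i, u i) + B := ciSup_le fun i => by
    linarith [(abs_le.1 (huv i)).1, le_ciSup hu i]
  exact abs_le.2 ⟨by linarith, by linarith⟩

lemma nonempty_closedBall_zero (m : ℕ) {L : ℝ} (hL : 0 ≤ L) :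
    Nonempty (Metric.closedBall (0 : E m) L) :=
  ⟨⟨0, Metric.mem_closedBall_self hL⟩⟩

lemma abs_discreteValue_le {n m : ℕ} (f : E n × E m → E n) {r : E n × E m → ℝ} {C γ L h : ℝ}
    (hL : 0 ≤ L) (hC : ∀ z, ‖r z‖ ≤ C) (hγ : 0 < γ) (hh : 0 < h) (h1 : h ≤ 1) (hγh : γ * h ≤ 1)
    (z : E n × E m) :
    |discreteValue f r γ L h z| ≤ ∫ t in Ioi (0 : ℝ), Real.exp γ * C * Real.exp (-γ * t) := by
  have := nonempty_closedBall_zero m hL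
  exact abs_ciSup_le fun b => abs_discreteReward_le hC hγ hh h1 hγh _

/-- The value function of the discrete-time problem solves the Bellman equation. -/
lemma bellman_discreteValue {n m : ℕ} (f : E n × E m → E n) {r : E n × E m → ℝ} {C γ L h : ℝ}
    (hL : 0 ≤ L) (hC : ∀ z, ‖r z‖ ≤ C) (hγ : 0 < γ) (hh : 0 < h) (h1 : h ≤ 1) (hγh : γ * h ≤ 1)
    (z : E n × E m) :
    bellman f r γ L h (discreteValue f r γ L h) z = discreteValue f r γ L h z := by
  have hne := nonempty_closedBall_zero m hL
  have hbdd : ∀ w, BddAbove (range fun b : ℕ → Metric.closedBall (0 : E m) L =>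
      discreteReward r γ h (discretePath f h (fun k => (b k : E m)) w)) := fun w =>
    bddAbove_range_of_abs_le fun b => abs_discreteReward_le hC hγ hh h1 hγh _
  have hbdd' : BddAbove (range fun b : Metric.closedBall (0 : E m) L =>
      discreteValue f r γ L h (flow f z.1 z.2 h, z.2 + h • (b : E m))) :=
    bddAbove_range_of_abs_le fun b => abs_discreteValue_le f hL hC hγ hh h1 hγh _
  have hw : 0 ≤ 1 - γ * h := by linarith
  have hstep : ∀ b : ℕ → Metric.closedBall (0 : E m) L,
      discreteReward r γ h (discretePath f h (fun k => (b k : E m)) z) =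
        h * r z + (1 - γ * h) * discreteReward r γ h (discretePath f h
          (fun k => (b (k + 1) : E m)) (flow f z.1 z.2 h, z.2 + h • (b 0 : E m))) := fun b => by
    rw [discreteReward_eq_add hC hγ hh h1 hγh]
    simp only [discretePath_succ_eq]
    rfl
  unfold bellman
  apply le_antisymm
  · rw [Real.mul_iSup_of_nonneg hw, ← le_sub_iff_add_le']
    refine ciSup_le fun b₀ => ?_
    rw [discreteValue, Real.mul_iSup_of_nonneg hw]
    refine ciSup_le fun b => ?_
    rw [le_sub_iff_add_le']
    -- The competitor uses `b₀` first and then follows `b`.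
    have := le_ciSup (hbdd z) (fun k => Nat.casesOn k b₀ b)
    rw [hstep] at this
    exact this
  · refine ciSup_le fun b => ?_
    rw [hstep]
    have h2 := (le_ciSup (hbdd (flow f z.1 z.2 h, z.2 + h • (b 0 : E m)))
      fun k => b (k + 1)).trans (le_ciSup hbdd' (b 0))
    have h3 := mul_le_mul_of_nonneg_left h2 hw
    linarith

lemma abs_bellman_sub_le {n m : ℕ} (f : E n × E m → E n) (r : E n × E m → ℝ) {γ L h B D : ℝ}
    (hL : 0 ≤ L) (hγh : γ * h ≤ 1) {q v : E n × E m → ℝ} (hv : ∀ z, |v z| ≤ B)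
    (hqv : ∀ z, |q z - v z| ≤ D) (z : E n × E m) :
    |bellman f r γ L h q z - bellman f r γ L h v z| ≤ (1 - γ * h) * D := by
  have := nonempty_closedBall_zero m hL
  have hw : 0 ≤ 1 - γ * h := by linarith
  -- Boundedness of `q` is needed because a real supremum of an unbounded family takes a default
  -- value.
  have hq : ∀ z, |q z| ≤ D + B := fun z => by
    calc |q z| = |(q z - v z) + v z| := by ring_nf
      _ ≤ |q z - v z| + |v z| := abs_add_le _ _
      _ ≤ D + B := add_le_add (hqv z) (hv z)
  unfold bellman
  rw [add_sub_add_left_eq_sub, ← mul_sub, abs_mul, abs_of_nonneg hw]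
  exact mul_le_mul_of_nonneg_left (abs_ciSup_sub_ciSup_le
    (bddAbove_range_of_abs_le fun b => hq _) (bddAbove_range_of_abs_le fun b => hv _)
    fun b => hqv _) hw

/-- Each step is a convex combination of the old error and one contracted by `1 - γ h`, so the
factors `1 - γ h α k` multiply up. -/
lemma abs_qIter_sub_le {n m : ℕ} (f : E n × E m → E n) (r : E n × E m → ℝ) {γ L h B D : ℝ}
    (hL : 0 ≤ L) (hγh : γ * h ≤ 1) {α : ℕ → ℝ} (hα : ∀ k, 0 ≤ α k ∧ α k ≤ 1)
    {q₀ v : E n × E m → ℝ} (hv : ∀ z, |v z| ≤ B) (hfix : ∀ z, bellman f r γ L h v z = v z)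
    (hD : 0 ≤ D) (hqv : ∀ z, |q₀ z - v z| ≤ D) (k : ℕ) (z : E n × E m) :
    |qIter f r γ L h α q₀ k z - v z| ≤
      D * Real.exp (-γ * (h * ∑ τ ∈ Finset.range k, α τ)) := by
  induction k generalizing z with
  | zero => simpa [qIter] using hqv z
  | succ k ih =>
    set G := D * Real.exp (-γ * (h * ∑ τ ∈ Finset.range k, α τ)) with hG
    have hG0 : 0 ≤ G := by positivity
    have hb := abs_bellman_sub_le f r hL hγh hv ih z
    rw [hfix] at hb
    have e : qIter f r γ L h α q₀ (k + 1) z - v z =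
        (1 - α k) * (qIter f r γ L h α q₀ k z - v z) +
          α k * (bellman f r γ L h (qIter f r γ L h α q₀ k) z - v z) := by
      simp only [qIter]; ring
    have hexp : D * Real.exp (-γ * (h * ∑ τ ∈ Finset.range (k + 1), α τ)) =
        G * Real.exp (-(γ * h * α k)) := by
      rw [hG, mul_assoc, ← Real.exp_add, Finset.sum_range_succ]; congr 2; ring
    rw [hexp, e]
    have h1 : 0 ≤ 1 - α k := by linarith [(hα k).2]
    calc _ ≤ (1 - α k) * G + α k * ((1 - γ * h) * G) := by
          refine (abs_add_le _ _).trans (add_le_add ?_ ?_)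
          · rw [abs_mul, abs_of_nonneg h1]; exact mul_le_mul_of_nonneg_left (ih z) h1
          · rw [abs_mul, abs_of_nonneg (hα k).1]; exact mul_le_mul_of_nonneg_left hb (hα k).1
      _ = G * (1 - γ * h * α k) := by ring
      _ ≤ _ := mul_le_mul_of_nonneg_left (Real.one_sub_le_exp_neg _) hG0

/-! ### Comparison of the two values and convergence -/

/-- The discrete value function is uniformly close to the continuous-time one. -/
lemma abs_discreteValue_sub_qFun_le {n m : ℕ} {f : E n × E m → E n} {r : E n × E m → ℝ}
    (hf : BoundedLipschitz f) {A : ℝ} (hA : ∀ z, ‖f z‖ ≤ A) {K : ℝ≥0} (hK : LipschitzWith K f)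
    (hK0 : (K : ℝ) ≠ 0) {C : ℝ} (hC : ∀ z, ‖r z‖ ≤ C) {D : ℝ≥0} (hD : LipschitzWith D r)
    {γ L : ℝ} (hγ : 0 < γ) (hL : 0 ≤ L) {h : ℝ} (hh : 0 < h) (h1 : h ≤ 1) (hγh : γ * h ≤ 1)
    (z : E n × E m) :
    |discreteValue f r γ L h z - qFun f r γ L z| ≤
      ∫ t in Ioi (0 : ℝ), discrepancy C D A L K γ h t := by
  have hne := nonempty_closedBall_zero m hL
  set ω := ∫ t in Ioi (0 : ℝ), discrepancy C D A L K γ h t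
  have hbdd : BddAbove {J : ℝ | ∃ (a : ℝ → E m) (x : ℝ → E n),
      IsAdmissible L a ∧ a 0 = z.2 ∧ IsTrajectory f a z.1 x ∧ J = reward r γ x a} := by
    refine ⟨∫ t in Ioi (0 : ℝ), C * Real.exp (-γ * t), ?_⟩
    rintro _ ⟨a, x, -, -, -, rfl⟩
    exact (le_abs_self _).trans (abs_reward_le hC hγ x a)
  have hup : ∀ b : ℕ → Metric.closedBall (0 : E m) L,
      discreteReward r γ h (discretePath f h (fun k => (b k : E m)) z) ≤ qFun f r γ L z + ω := by
    intro b
    have hb : ∀ k, ‖(b k : E m)‖ ≤ L := fun k => mem_closedBall_zero_iff.1 (b k).2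
    set a := stepControl h (fun k => (b k : E m)) z.2 with ha
    have hadm : IsAdmissible L a := isAdmissible_stepControl hL hb h z.2
    have ha0 : a 0 = z.2 := by simp [ha, stepControl]
    have hac : ContinuousOn a (Ici 0) :=
      (lipschitzWith_stepControl hL hb h z.2).continuous.continuousOn
    obtain ⟨x, hx⟩ := exists_isTrajectory hf hac z.1
    have hpa : ∀ k : ℕ, (discretePath f h (fun k => (b k : E m)) z k).2 = a (k * h) := by
      intro k
      induction k with
      | zero => simp [discretePath, ha0]
      | succ k ih => rw [discretePath, ih, ha, stepControl_succ hb hh]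
    have key := abs_reward_sub_discreteReward_le hf hA hK hK0 hC hD hγ hL hac
      (fun s t hs hst => hadm.norm_sub_le hs hst) hx hh h1 hγh
      (p := discretePath f h (fun k => (b k : E m)) z) rfl (fun k => rfl) hpa
    have hle : reward r γ x a ≤ qFun f r γ L z := le_csSup hbdd ⟨a, x, hadm, ha0, hx, rfl⟩
    linarith [(abs_le.1 key).1]
  have hbddV : BddAbove (range fun b : ℕ → Metric.closedBall (0 : E m) L =>
      discreteReward r γ h (discretePath f h (fun k => (b k : E m)) z)) :=
    bddAbove_range_of_abs_le fun b => abs_discreteReward_le hC hγ hh h1 hγh _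
  have hlow : ∀ (a : ℝ → E m) (x : ℝ → E n), IsAdmissible L a → a 0 = z.2 →
      IsTrajectory f a z.1 x → reward r γ x a ≤ discreteValue f r γ L h z + ω := by
    intro a x hadm ha0 hx
    -- The mean velocities of `a` over the time steps reproduce its values at the nodes.
    have hb : ∀ k : ℕ, h⁻¹ • (a ((k + 1 : ℕ) * h) - a (k * h)) ∈ Metric.closedBall (0 : E m) L := by
      intro k
      have hk := hadm.norm_sub_le (s := k * h) (t := (k + 1 : ℕ) * h) (by positivity)
        (by push_cast; linarith)
      rw [mem_closedBall_zero_iff, norm_smul, Real.norm_of_nonneg (inv_nonneg.2 hh.le),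
        inv_mul_le_iff₀ hh]
      refine hk.trans_eq ?_
      push_cast; ring
    set b : ℕ → Metric.closedBall (0 : E m) L := fun k => ⟨_, hb k⟩ with hbdef
    have hpa : ∀ k : ℕ, (discretePath f h (fun k => (b k : E m)) z k).2 = a (k * h) := by
      intro k
      induction k with
      | zero => simp [discretePath, ha0]
      | succ k ih =>
        rw [discretePath, ih]
        simp only [hbdef, smul_inv_smul₀ hh.ne', add_sub_cancel]
    obtain ⟨c, hc⟩ := hadm.1
    have key := abs_reward_sub_discreteReward_le hf hA hK hK0 hC hD hγ hL hc.continuousOn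
      (fun s t hs hst => hadm.norm_sub_le hs hst) hx hh h1 hγh
      (p := discretePath f h (fun k => (b k : E m)) z) rfl (fun k => rfl) hpa
    have hle := le_ciSup hbddV b
    change _ ≤ discreteValue f r γ L h z at hle
    linarith [(abs_le.1 key).2]
  have hlow' : qFun f r γ L z ≤ discreteValue f r γ L h z + ω := by
    -- The constant control shows that the set of rewards is nonempty, as `csSup_le` requires.
    obtain ⟨x, hx⟩ := exists_isTrajectory hf (a := fun _ => z.2) continuousOn_const z.1
    refine csSup_le ⟨_, fun _ => z.2, x, ⟨⟨0, ?_⟩, ?_⟩, rfl, hx, rfl⟩ ?_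
    · exact (LipschitzWith.const z.2).lipschitzOnWith
    · exact Eventually.of_forall fun t => by simpa using hL
    · rintro _ ⟨a, x, hadm, ha0, hx, rfl⟩
      exact hlow a x hadm ha0 hx
  have hup' : discreteValue f r γ L h z ≤ qFun f r γ L z + ω := ciSup_le hup
  exact abs_le.2 ⟨by linarith, by linarith⟩

lemma exists_tendsto_mul_sum_atTop {α : ℕ → ℝ}
    (hsum : Tendsto (fun k : ℕ => ∑ τ ∈ Finset.range k, α τ) atTop atTop) :
    ∃ κ : ℝ → ℕ,
      Tendsto (fun h : ℝ => h * ∑ τ ∈ Finset.range (κ h), α τ) (𝓝[>] 0) atTop := by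
  -- Partial sums of size `h⁻²` make the product with `h` at least `h⁻¹`.
  choose κ hκ using fun h : ℝ => (hsum.eventually_ge_atTop (h⁻¹ * h⁻¹)).exists
  refine ⟨κ, tendsto_atTop_mono' _ ?_ (tendsto_inv_nhdsGT_zero (𝕜 := ℝ))⟩
  filter_upwards [self_mem_nhdsWithin] with h hh
  have hh0 : (0 : ℝ) < h := hh
  calc h⁻¹ = h * (h⁻¹ * h⁻¹) := by field_simp
    _ ≤ _ := mul_le_mul_of_nonneg_left (hκ h) hh0.le

/-- The iterates converge to the continuous-time Q-function uniformly on the whole space. -/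
lemma exists_tendsto_bound_qIter_sub_qFun {n m : ℕ} {f : E n × E m → E n} {r : E n × E m → ℝ}
    (hf : BoundedLipschitz f) (hr : BoundedLipschitz r) {γ L : ℝ} (hγ : 0 < γ) (hL : 0 ≤ L)
    {α : ℕ → ℝ} (hα : ∀ k, 0 ≤ α k ∧ α k ≤ 1) {q₀ : ℝ → E n × E m → ℝ} {M : ℝ}
    (hM : ∀ᶠ h in 𝓝[>] (0 : ℝ), ∀ z, |q₀ h z| ≤ M) {κ : ℝ → ℕ}
    (hκ : Tendsto (fun h : ℝ => h * ∑ τ ∈ Finset.range (κ h), α τ) (𝓝[>] 0) atTop) :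
    ∃ ε : ℝ → ℝ, Tendsto ε (𝓝[>] 0) (𝓝 0) ∧ ∀ᶠ h in 𝓝[>] (0 : ℝ), ∀ k, κ h ≤ k → ∀ z,
      |qIter f r γ L h α (q₀ h) k z - qFun f r γ L z| ≤ ε h := by
  obtain ⟨⟨A, hA⟩, K₀, hK₀⟩ := id hf
  obtain ⟨⟨C, hC⟩, D, hD⟩ := hr
  -- Enlarging the constant makes it nonzero, so the closed form of the Gronwall bound applies.
  have hK : LipschitzWith (K₀ + 1) f := hK₀.weaken le_self_add
  have hK0 : ((K₀ + 1 : ℝ≥0) : ℝ) ≠ 0 := by positivity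
  have hA0 : 0 ≤ A := (norm_nonneg _).trans (hA 0)
  have hC0 : 0 ≤ C := (norm_nonneg _).trans (hC 0)
  -- `B` bounds the discrete value for all small `h`, so `|M| + B` bounds the initial error
  -- uniformly in `h`.
  set B := ∫ t in Ioi (0 : ℝ), Real.exp γ * C * Real.exp (-γ * t) with hB
  have hB0 : 0 ≤ B := integral_nonneg fun t => by positivity
  refine ⟨fun h => (|M| + B) * Real.exp (-γ * (h * ∑ τ ∈ Finset.range (κ h), α τ)) +
    ∫ t in Ioi (0 : ℝ), discrepancy C D A L (K₀ + 1 : ℝ≥0) γ h t, ?_, ?_⟩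
  · have h1 : Tendsto (fun h : ℝ => Real.exp (-γ * (h * ∑ τ ∈ Finset.range (κ h), α τ)))
        (𝓝[>] 0) (𝓝 0) :=
      Real.tendsto_exp_atBot.comp (hκ.const_mul_atTop_of_neg (neg_lt_zero.2 hγ))
    simpa using (h1.const_mul (|M| + B)).add
      (tendsto_integral_discrepancy (K₀ + 1 : ℝ≥0) hC0 D.2 hA0 hL hγ)
  · filter_upwards [hM, eventually_small_step γ] with h hMh hsmall k hk z
    obtain ⟨hh, h1, hγh⟩ := hsmall
    have hV := abs_discreteValue_le f hL hC hγ hh h1 hγh.le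
    have hqv : ∀ z, |q₀ h z - discreteValue f r γ L h z| ≤ |M| + B := fun z =>
      (abs_sub _ _).trans (add_le_add ((hMh z).trans (le_abs_self M)) (hV z))
    have hit := abs_qIter_sub_le f r hL hγh.le hα hV
      (bellman_discreteValue f hL hC hγ hh h1 hγh.le) (by positivity) hqv k z
    have hcmp := abs_discreteValue_sub_qFun_le hf hA hK hK0 hC hD hγ hL hh h1 hγh.le z
    have hmono : ∑ τ ∈ Finset.range (κ h), α τ ≤ ∑ τ ∈ Finset.range k, α τ :=
      Finset.sum_le_sum_of_subset_of_nonneg (Finset.range_mono hk) fun τ _ _ => (hα τ).1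
    have hexp : Real.exp (-γ * (h * ∑ τ ∈ Finset.range k, α τ)) ≤
        Real.exp (-γ * (h * ∑ τ ∈ Finset.range (κ h), α τ)) := by
      refine Real.exp_le_exp.2 ?_
      have := mul_le_mul_of_nonneg_left (mul_le_mul_of_nonneg_left hmono hh.le) hγ.le
      linarith
    have hMB : 0 ≤ |M| + B := by positivity
    exact (abs_sub_le _ (discreteValue f r γ L h z) _).trans
      (add_le_add (hit.trans (mul_le_mul_of_nonneg_left hexp hMB)) hcmp)

end HJQ

theorem corollary1 {n m : ℕ} (f : HJQ.E n × HJQ.E m → HJQ.E n) (r : HJQ.E n × HJQ.E m → ℝ)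
    (hf : HJQ.BoundedLipschitz f) (hr : HJQ.BoundedLipschitz r)
    (γ L : ℝ) (hγ : 0 < γ) (hL : 0 ≤ L)
    (α : ℕ → ℝ) (hα : ∀ k, 0 ≤ α k ∧ α k ≤ 1)
    (hsum : Tendsto (fun k : ℕ => ∑ τ ∈ Finset.range k, α τ) atTop atTop)
    (q₀ : ℝ → HJQ.E n × HJQ.E m → ℝ)
    (hq₀ : ∃ M : ℝ, ∀ᶠ h in 𝓝[>] (0 : ℝ), ∀ z, |q₀ h z| ≤ M) :
    (∃ κ : ℝ → ℕ,
      Tendsto (fun h : ℝ => h * ∑ τ ∈ Finset.range (κ h), α τ) (𝓝[>] 0) atTop) ∧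
    ∀ κ : ℝ → ℕ,
      Tendsto (fun h : ℝ => h * ∑ τ ∈ Finset.range (κ h), α τ) (𝓝[>] 0) atTop →
      ∀ K : Set (HJQ.E n × HJQ.E m), IsCompact K →
        Tendsto
          (fun h : ℝ => ⨆ (k : ℕ) (_ : κ h ≤ k) (z : HJQ.E n × HJQ.E m) (_ : z ∈ K),
            ENNReal.ofReal |HJQ.qIter f r γ L h α (q₀ h) k z - HJQ.qFun f r γ L z|)
          (𝓝[>] 0) (𝓝 0) := by
  refine ⟨HJQ.exists_tendsto_mul_sum_atTop hsum, fun κ hκ K _ => ?_⟩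
  obtain ⟨M, hM⟩ := hq₀
  obtain ⟨ε, hε, hle⟩ := HJQ.exists_tendsto_bound_qIter_sub_qFun hf hr hγ hL hα hM hκ
  have hε' : Tendsto (fun h => ENNReal.ofReal (ε h)) (𝓝[>] 0) (𝓝 0) := by
    simpa using ENNReal.tendsto_ofReal hε
  refine tendsto_of_tendsto_of_tendsto_of_le_of_le' tendsto_const_nhds hε'
    (Eventually.of_forall fun _ => zero_le) ?_
  filter_upwards [hle] with h hh
  exact iSup₂_le fun k hk => iSup₂_le fun z _ => ENNReal.ofReal_le_ofReal (hh k hk z)
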